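/- Let $S=S_{g,n}$ be a connected orientable surface of genus $g$ without boundary, with finitely many ($n\ge 0$) punctures or marked points, $S\neq S_{1,2}$. Let $\mathrm{Mod}^{\pm}(S)$ be the extended mapping class group (all self-homeomorphisms of $S$ up to isotopy) and $\mathrm{Mod}(S)$ its subgroup of orientation preserving classes. A simple closed curve is essential if it does not bound a disk containing at most one puncture. Let $\mathcal C(S)$ be the curve complex: its vertices are the isotopy classes of essential simple closed curves, and its simplices are the finite sets of distinct vertices with pairwise disjoint representatives; for $S_{1,0}$, $S_{1,1}$ and $S_{0,4}$ it is instead the flag complex in which $\alpha,\beta$ are adjacent if $i(\alpha,\beta)=1$, $1$ and $2$, respectively. A set of vertices is identified with the subcomplex it spans. A set $Y\subset\mathcal C(S)$ is *rigid* if for every simplicial map $\phi:Y\to\mathcal C(S)$ that is injective on the star of each vertex of $Y$ there is $h\in\mathrm{Mod}^{\pm}(S)$ with $h|_Y=\phi$, unique up to the pointwise stabilizer of $Y$ in $\mathrm{Mod}^{\pm}(S)$. It is *weakly rigid* if $h|_Y=h'|_Y$ with $h,h'\in\mathrm{Mod}^{\pm}(S)$ implies $h=h'$, i.e. if its pointwise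 stabilizer in $\mathrm{Mod}^{\pm}(S)$ is trivial. Let $Y\subset\mathcal C(S)$ be a finite rigid set such that $\mathrm{Mod}(S)\cdot Y=\mathcal C(S)$. Suppose there are a nonempty set $G\subset Y$ and, for each $\alpha\in G$, a mapping class $f_\alpha$ which is either the Dehn twist $T_\alpha$ or (where $\alpha$ cuts off a disk with exactly two punctures) a half twist $H_\alpha$ about $\alpha$, such that: 1. the set $\{f_\alpha\mid\alpha\in G\}$ generates $\mathrm{Mod}(S)$; 2. $Y\cap f_\alpha(Y)$ is weakly rigid for every $\alpha\in G$. Then there is a sequence $Y=Y_1\subset Y_2\subset\cdots\subset Y_n\subset\cdots$ such that every $Y_i$ is a finite rigid set with trivial pointwise stabilizer in $\mathrm{Mod}^{\pm}(S)$, and $\bigcup_{i\in\mathbb N}Y_i=\mathcal C(S)$. -/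

import Mathlib

open scoped Pointwise

noncomputable section

namespace CurveComplex

/-! A surface of finite type is modelled by a pair `(M, P)`: a closed connected surface `M`
(a compact connected Hausdorff space with charts in `ℂ = ℝ²`) with an oriented atlas, and a
finite set `P` of marked points. Curves live in `M \ P`; homeomorphisms and isotopies
preserve `P`. No complex structure on `M` is used, only its topology and orientation. -/

section Orientation

/-- The closed path `γ : [0,1] → ℂ \ {w}` has winding number `n` around `w`:
`γ = w + exp θ` for a continuous `θ` which changes by `2 π i n`.
(Continuity of `γ` is implied.) -/
def HasWinding (γ : unitInterval → ℂ) (w : ℂ) (n : ℤ) : Prop :=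
  ∃ θ : unitInterval → ℂ, Continuous θ ∧ (∀ t, γ t = w + Complex.exp (θ t)) ∧
    θ 1 = θ 0 + n * (2 * Real.pi * Complex.I)

/-- A map between plane domains which is a local homeomorphism at `z` preserves the orientation
at `z` (has local degree one) if it preserves winding numbers of small loops around `z`. -/
def PreservesOrientationAt (f : ℂ → ℂ) (z : ℂ) : Prop :=
  ∃ U ∈ nhds z, ∀ γ : unitInterval → ℂ, (∀ t, γ t ∈ U) →
    ∀ n : ℤ, HasWinding γ z n ↔ HasWinding (f ∘ γ) (f z) n

theorem PreservesOrientationAt.comp {f g : ℂ → ℂ} {z : ℂ} (hg : PreservesOrientationAt g (f z))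
    (hf : PreservesOrientationAt f z) (hc : ContinuousAt f z) :
    PreservesOrientationAt (g ∘ f) z := by
  obtain ⟨U, hU, hU'⟩ := hf
  obtain ⟨W, hW, hW'⟩ := hg
  refine ⟨U ∩ f ⁻¹' W, Filter.inter_mem hU (hc hW), fun γ hγ n => ?_⟩
  rw [hU' γ (fun t => (hγ t).1) n]
  exact hW' (f ∘ γ) (fun t => (hγ t).2) n

theorem PreservesOrientationAt.congr {f g : ℂ → ℂ} {z : ℂ} (hf : PreservesOrientationAt f z)
    (hfg : f =ᶠ[nhds z] g) : PreservesOrientationAt g z := by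
  obtain ⟨U, hU, hU'⟩ := hf
  refine ⟨U ∩ {x | f x = g x}, Filter.inter_mem hU hfg, fun γ hγ n => ?_⟩
  rw [hU' γ (fun t => (hγ t).1) n, hfg.eq_of_nhds]
  have : f ∘ γ = g ∘ γ := funext fun t => (hγ t).2
  rw [this]

theorem preservesOrientationAt_id (z : ℂ) : PreservesOrientationAt id z :=
  ⟨Set.univ, Filter.univ_mem, fun _ _ _ => Iff.rfl⟩

/-- A local inverse of an orientation preserving map is orientation preserving. -/
theorem PreservesOrientationAt.symm {f g : ℂ → ℂ} {z : ℂ} (hf : PreservesOrientationAt f z)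
    (hg : ContinuousAt g (f z)) (hgz : g (f z) = z)
    (hfg : ∀ᶠ w in nhds (f z), f (g w) = w) : PreservesOrientationAt g (f z) := by
  obtain ⟨U, hU, hU'⟩ := hf
  rw [← hgz] at hU
  refine ⟨g ⁻¹' U ∩ {w | f (g w) = w}, Filter.inter_mem (hg hU) hfg, fun γ hγ n => ?_⟩
  rw [hgz, hU' (g ∘ γ) (fun t => (hγ t).1) n]
  have : f ∘ (g ∘ γ) = γ := funext fun t => (hγ t).2
  rw [this]

/-- The atlas of the surface `M` is oriented: all transition maps preserve orientation. -/
class OrientedAtlas (M : Type*) [TopologicalSpace M] [ChartedSpace ℂ M] : Prop where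
  transition : ∀ e ∈ atlas ℂ M, ∀ e' ∈ atlas ℂ M, ∀ z ∈ (e.symm.trans e').source,
    PreservesOrientationAt (e.symm.trans e') z

variable {M : Type*} [TopologicalSpace M] [ChartedSpace ℂ M]

/-- The homeomorphism `h` preserves the orientation given by the atlas. -/
def OrientationPreserving (h : M ≃ₜ M) : Prop :=
  ∀ x : M, PreservesOrientationAt
    (chartAt ℂ (h x) ∘ h ∘ (chartAt ℂ x).symm) (chartAt ℂ x x)

theorem continuousAt_chart (h : M ≃ₜ M) (x : M) :
    ContinuousAt (chartAt ℂ (h x) ∘ h ∘ (chartAt ℂ x).symm) (chartAt ℂ x x) := by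
  have h1 : ContinuousAt (chartAt ℂ x).symm (chartAt ℂ x x) :=
    (chartAt ℂ x).continuousAt_symm (mem_chart_target ℂ x)
  have h2 : ContinuousAt (chartAt ℂ (h x)) (h x) :=
    (chartAt ℂ (h x)).continuousAt (mem_chart_source ℂ (h x))
  have e : (chartAt ℂ x).symm (chartAt ℂ x x) = x :=
    (chartAt ℂ x).left_inv (mem_chart_source ℂ x)
  refine ContinuousAt.comp ?_ (ContinuousAt.comp h.continuous.continuousAt h1)
  simpa [Function.comp, e] using h2

/-- Near `x`, passing through the chart at `h x` does nothing. -/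
theorem eventually_chart_cancel (h : M ≃ₜ M) (x : M) :
    ∀ᶠ z in nhds (chartAt ℂ x x), (chartAt ℂ (h x)).symm
      (chartAt ℂ (h x) (h ((chartAt ℂ x).symm z))) = h ((chartAt ℂ x).symm z) := by
  have h1 : ContinuousAt (chartAt ℂ x).symm (chartAt ℂ x x) :=
    (chartAt ℂ x).continuousAt_symm (mem_chart_target ℂ x)
  have e : (chartAt ℂ x).symm (chartAt ℂ x x) = x :=
    (chartAt ℂ x).left_inv (mem_chart_source ℂ x)
  have h2 : ContinuousAt (h ∘ (chartAt ℂ x).symm) (chartAt ℂ x x) :=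
    ContinuousAt.comp h.continuous.continuousAt h1
  have h3 : (chartAt ℂ (h x)).source ∈ nhds ((h ∘ (chartAt ℂ x).symm) (chartAt ℂ x x)) := by
    simpa [Function.comp, e] using chart_source_mem_nhds ℂ (h x)
  filter_upwards [h2 h3] with z hz
  exact (chartAt ℂ (h x)).left_inv hz

theorem orientationPreserving_one : OrientationPreserving (1 : M ≃ₜ M) := by
  intro x
  refine (preservesOrientationAt_id _).congr ?_
  filter_upwards [(chartAt ℂ x).open_target.mem_nhds (mem_chart_target ℂ x)] with z hz
  exact ((chartAt ℂ x).right_inv hz).symm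

theorem OrientationPreserving.mul {g h : M ≃ₜ M} (hg : OrientationPreserving g)
    (hh : OrientationPreserving h) : OrientationPreserving (g * h) := by
  intro x
  have e : (chartAt ℂ x).symm (chartAt ℂ x x) = x :=
    (chartAt ℂ x).left_inv (mem_chart_source ℂ x)
  have hg' := hg (h x)
  have key := PreservesOrientationAt.comp (f := chartAt ℂ (h x) ∘ h ∘ (chartAt ℂ x).symm)
    (by simpa [Function.comp, e] using hg') (hh x) (continuousAt_chart h x)
  refine key.congr ?_
  filter_upwards [eventually_chart_cancel h x] with z hz
  simp only [Function.comp_apply, Homeomorph.mul_apply, hz]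

theorem OrientationPreserving.inv {h : M ≃ₜ M} (hh : OrientationPreserving h) :
    OrientationPreserving h⁻¹ := by
  intro y
  obtain ⟨x, rfl⟩ := h.surjective y
  have e : (chartAt ℂ x).symm (chartAt ℂ x x) = x :=
    (chartAt ℂ x).left_inv (mem_chart_source ℂ x)
  have hx : h⁻¹ (h x) = x := h.symm_apply_apply x
  have e2 : (chartAt ℂ (h x) ∘ h ∘ (chartAt ℂ x).symm) (chartAt ℂ x x)
      = chartAt ℂ (h x) (h x) := by simp [e]
  have hc := continuousAt_chart h⁻¹ (h x)
  have hev := eventually_chart_cancel h⁻¹ (h x)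
  rw [hx] at hc hev ⊢
  have e3 : (chartAt ℂ (h x)).symm (chartAt ℂ (h x) (h x)) = h x :=
    (chartAt ℂ (h x)).left_inv (mem_chart_source ℂ (h x))
  have := (hh x).symm (g := chartAt ℂ x ∘ (h⁻¹ : M ≃ₜ M) ∘ (chartAt ℂ (h x)).symm)
    (by rw [e2]; exact hc) (by rw [e2]; simp [e3]) ?_
  · rwa [e2] at this
  · rw [e2]
    filter_upwards [hev, (chartAt ℂ (h x)).open_target.mem_nhds (mem_chart_target ℂ (h x))]
      with z hz hz'
    simp only [Function.comp_apply, hz]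
    rw [show h (h⁻¹ ((chartAt ℂ (h x)).symm z)) = (chartAt ℂ (h x)).symm z from
      h.apply_symm_apply _]
    exact (chartAt ℂ (h x)).right_inv hz'

end Orientation

section MappingClassGroup

variable (M : Type*) [TopologicalSpace M] (P : Set M)

/-- `Homeo(M, P)`: the homeomorphisms of `M` which map the set `P` of marked points to itself. -/
def homeoGroup : Subgroup (M ≃ₜ M) where
  carrier := {h | h '' P = P}
  mul_mem' {a b} ha hb := by
    have : (a * b : M ≃ₜ M) '' P = a '' (b '' P) := by
      rw [Set.image_image]; rfl
    simpa [this] using (by rw [hb.out, ha.out] : a '' (b '' P) = P)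
  one_mem' := Set.image_id P
  inv_mem' {a} ha := by
    have : (a⁻¹ : M ≃ₜ M) '' (a '' P) = P := by
      rw [Set.image_image]
      simp
    rw [ha.out] at this
    exact this

/-- The homeomorphisms of `(M, P)` which are isotopic to the identity, through homeomorphisms
of `(M, P)`. -/
def isotopySubgroup : Subgroup (homeoGroup M P) where
  carrier := {h | ∃ F : unitInterval → homeoGroup M P,
    Continuous (fun q : unitInterval × M => (F q.1 : M ≃ₜ M) q.2) ∧ F 0 = 1 ∧ F 1 = h}
  mul_mem' := by
    rintro a b ⟨F, hF, hF0, hF1⟩ ⟨G, hG, hG0, hG1⟩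
    refine ⟨fun t => F t * G t, ?_, by simp [hF0, hG0], by simp [hF1, hG1]⟩
    exact hF.comp (continuous_fst.prodMk hG)
  one_mem' := ⟨fun _ => 1, by simpa using continuous_snd, rfl, rfl⟩
  inv_mem' := by
    rintro a ⟨F, hF, hF0, hF1⟩
    refine ⟨fun t => F (unitInterval.symm t) * a⁻¹, ?_, by simp [hF1], by simp [hF0]⟩
    exact hF.comp ((unitInterval.continuous_symm.comp continuous_fst).prodMk
      ((a⁻¹ : homeoGroup M P).1.continuous.comp continuous_snd))

instance isotopySubgroup_normal : (isotopySubgroup M P).Normal where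
  conj_mem := by
    rintro a ⟨F, hF, hF0, hF1⟩ g
    refine ⟨fun t => g * F t * g⁻¹, ?_, by simp [hF0], by simp [hF1]⟩
    exact g.1.continuous.comp (hF.comp (continuous_fst.prodMk
      ((g⁻¹ : homeoGroup M P).1.continuous.comp continuous_snd)))

/-- The extended mapping class group `Mod^±(S)`: homeomorphisms of `(M, P)` up to isotopy. -/
abbrev ExtMod : Type _ := homeoGroup M P ⧸ isotopySubgroup M P

/-- The orientation preserving homeomorphisms of `(M, P)`. -/
def orientedHomeoGroup [ChartedSpace ℂ M] : Subgroup (homeoGroup M P) where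
  carrier := {h | OrientationPreserving (h : M ≃ₜ M)}
  mul_mem' ha hb := OrientationPreserving.mul ha hb
  one_mem' := orientationPreserving_one
  inv_mem' ha := OrientationPreserving.inv ha

/-- The mapping class group `Mod(S)`: the classes of orientation preserving homeomorphisms. -/
def ModGroup [ChartedSpace ℂ M] : Subgroup (ExtMod M P) :=
  (orientedHomeoGroup M P).map (QuotientGroup.mk' (isotopySubgroup M P))

end MappingClassGroup

section Curves

/-- The subset `c` of `M` bounds a closed disk containing at most one marked point. -/
def BoundsInessentialDisk {M : Type*} [TopologicalSpace M] (P : Set M) (c : Set M) : Prop :=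
  ∃ e : Metric.closedBall (0 : ℂ) 1 → M, Topology.IsEmbedding e ∧
    e '' {z | ‖(z : ℂ)‖ = 1} = c ∧ (Set.range e ∩ P).Subsingleton

variable (M : Type*) [TopologicalSpace M] (P : Set M)

/-- Essential (unoriented) simple closed curves on `(M, P)`, as subsets of `M \ P`. -/
structure EssentialCurve where
  carrier : Set M
  simpleClosed : ∃ e : Circle → M, Topology.IsEmbedding e ∧ Set.range e = carrier
  disjoint : Disjoint carrier P
  essential : ¬ BoundsInessentialDisk P carrier

variable {M P}

theorem EssentialCurve.ext' {a b : EssentialCurve M P} (h : a.carrier = b.carrier) : a = b := by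
  cases a; cases b; cases h; rfl

theorem homeoGroup_image (h : homeoGroup M P) : (h : M ≃ₜ M) '' P = P := h.2

theorem image_inv_image (h : homeoGroup M P) (s : Set M) :
    ((h⁻¹ : homeoGroup M P) : M ≃ₜ M) '' ((h : M ≃ₜ M) '' s) = s := by
  rw [Set.image_image]
  simp

theorem BoundsInessentialDisk.image {c : Set M} (hc : BoundsInessentialDisk P c)
    (h : homeoGroup M P) : BoundsInessentialDisk P ((h : M ≃ₜ M) '' c) := by
  obtain ⟨e, he, hec, hP⟩ := hc
  refine ⟨(h : M ≃ₜ M) ∘ e, (h : M ≃ₜ M).isEmbedding.comp he, by rw [Set.image_comp, hec], ?_⟩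
  have : Set.range ((h : M ≃ₜ M) ∘ e) ∩ P = (h : M ≃ₜ M) '' (Set.range e ∩ P) := by
    rw [Set.image_inter (h : M ≃ₜ M).injective, homeoGroup_image, Set.range_comp]
  rw [this]
  exact hP.image _

/-- The image of a curve under a homeomorphism of `(M, P)`. -/
def EssentialCurve.map (h : homeoGroup M P) (c : EssentialCurve M P) : EssentialCurve M P where
  carrier := (h : M ≃ₜ M) '' c.carrier
  simpleClosed := by
    obtain ⟨e, he, hc⟩ := c.simpleClosed
    exact ⟨(h : M ≃ₜ M) ∘ e, (h : M ≃ₜ M).isEmbedding.comp he, by rw [Set.range_comp, hc]⟩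
  disjoint := by
    have := (Set.disjoint_image_iff (h : M ≃ₜ M).injective).2 c.disjoint
    rwa [homeoGroup_image] at this
  essential hb := by
    have := hb.image h⁻¹
    rw [image_inv_image] at this
    exact c.essential this

instance : MulAction (homeoGroup M P) (EssentialCurve M P) where
  smul := EssentialCurve.map
  one_smul _ := EssentialCurve.ext' (Set.image_id _)
  mul_smul a b c := EssentialCurve.ext' (Set.image_comp (a : M ≃ₜ M) (b : M ≃ₜ M) c.carrier)

theorem EssentialCurve.carrier_smul (h : homeoGroup M P) (c : EssentialCurve M P) :
    (h • c).carrier = (h : M ≃ₜ M) '' c.carrier := rfl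

variable (M P) in
/-- Isotopy classes of essential simple closed curves: two curves are isotopic if an isotopy
of `(M, P)` starting at the identity carries one to the other. -/
def Vertex : Type _ :=
  MulAction.orbitRel.Quotient (isotopySubgroup M P) (EssentialCurve M P)

/-- The isotopy class of a curve. -/
def EssentialCurve.toVertex (c : EssentialCurve M P) : Vertex M P :=
  Quotient.mk (MulAction.orbitRel (isotopySubgroup M P) (EssentialCurve M P)) c

theorem toVertex_eq_iff {a b : EssentialCurve M P} :
    a.toVertex = b.toVertex ↔ ∃ g ∈ isotopySubgroup M P, g • b = a := by
  refine (Quotient.eq (r := MulAction.orbitRel _ _)).trans ?_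
  rw [MulAction.orbitRel_apply, MulAction.mem_orbit_iff]
  exact ⟨fun ⟨g, hg⟩ => ⟨g.1, g.2, hg⟩, fun ⟨g, hg, h⟩ => ⟨⟨g, hg⟩, h⟩⟩

theorem toVertex_surjective : Function.Surjective (EssentialCurve.toVertex (M := M) (P := P)) :=
  Quotient.mk_surjective

/-- `[h] • [c] = [h(c)]`. -/
def vertexSMul (g : ExtMod M P) (v : Vertex M P) : Vertex M P :=
  Quotient.liftOn₂ g v (fun h c => (h • c).toVertex) (by
    intro h _ h' c' hh hc
    have h1 : h⁻¹ * h' ∈ isotopySubgroup M P := QuotientGroup.leftRel_apply.1 hh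
    have h2 := Quotient.sound hc
    obtain ⟨k, hk, rfl⟩ := toVertex_eq_iff.1 h2
    refine toVertex_eq_iff.2 ⟨h * (k * (h⁻¹ * h')⁻¹) * h⁻¹, ?_, ?_⟩
    · exact Subgroup.Normal.conj_mem inferInstance _ (mul_mem hk (inv_mem h1)) _
    · simp only [smul_smul]
      congr 1
      group)

/-- The action of `Mod^±(S)` on isotopy classes of curves. -/
instance : MulAction (ExtMod M P) (Vertex M P) where
  smul := vertexSMul
  one_smul v := by
    obtain ⟨c, rfl⟩ := toVertex_surjective v
    exact congrArg EssentialCurve.toVertex (one_smul (homeoGroup M P) c)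
  mul_smul a b v := by
    obtain ⟨c, rfl⟩ := toVertex_surjective v
    obtain ⟨a, rfl⟩ := QuotientGroup.mk_surjective a
    obtain ⟨b, rfl⟩ := QuotientGroup.mk_surjective b
    exact congrArg EssentialCurve.toVertex (mul_smul a b c)

theorem mk_smul_toVertex (h : homeoGroup M P) (c : EssentialCurve M P) :
    (h : ExtMod M P) • c.toVertex = (h • c).toVertex := rfl

end Curves

section Complex

variable (M : Type*) [TopologicalSpace M] (P : Set M)

/-- `S` is a torus with at most one marked point: `S_{1,0}` or `S_{1,1}`. -/
def IsS10OrS11 : Prop := Nonempty (M ≃ₜ Circle × Circle) ∧ P.ncard ≤ 1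

/-- `S` is a torus with two marked points. -/
def IsS12 : Prop := Nonempty (M ≃ₜ Circle × Circle) ∧ P.ncard = 2

/-- `S` is a sphere with four marked points. -/
def IsS04 : Prop :=
  Nonempty (M ≃ₜ Metric.sphere (0 : EuclideanSpace ℝ (Fin 3)) 1) ∧ P.ncard = 4

variable {M P}

/-- The geometric intersection number `i(α, β)`: the least number of intersection points of
representatives of `α` and `β`. -/
def interNum (α β : Vertex M P) : ℕ∞ :=
  sInf {n | ∃ a b : EssentialCurve M P, a.toVertex = α ∧ b.toVertex = β ∧
    n = (a.carrier ∩ b.carrier).encard}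

variable (M P) in
/-- The curve complex: simplices are the nonempty finite sets of isotopy classes with pairwise
disjoint representatives, except that for `S_{1,0}`, `S_{1,1}` and `S_{0,4}` it is the flag
complex of the graph in which distinct classes are adjacent if they intersect once, once
and twice, respectively. -/
def curveComplex : AbstractSimplicialComplex (Vertex M P) where
  faces := {s | s.Nonempty ∧
    (IsS10OrS11 M P → (s : Set (Vertex M P)).Pairwise fun α β => interNum α β = 1) ∧
    (IsS04 M P → (s : Set (Vertex M P)).Pairwise fun α β => interNum α β = 2) ∧
    (¬ IsS10OrS11 M P → ¬ IsS04 M P → ∃ r : Vertex M P → EssentialCurve M P,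
      (∀ α ∈ s, (r α).toVertex = α) ∧
      (s : Set (Vertex M P)).Pairwise fun α β => Disjoint (r α).carrier (r β).carrier)}
  isRelLowerSet_faces := by
    rintro s ⟨hs, h1, h2, h3⟩
    refine ⟨hs, fun t hts ht => ⟨ht, fun h => (h1 h).mono (by exact_mod_cast hts),
      fun h => (h2 h).mono (by exact_mod_cast hts), fun h h' => ?_⟩⟩
    obtain ⟨r, hr, hr'⟩ := h3 h h'
    exact ⟨r, fun α hα => hr α (hts hα), hr'.mono (by exact_mod_cast hts)⟩
  singleton_mem v := by
    refine ⟨Finset.singleton_nonempty v, fun _ => by simp, fun _ => by simp, fun _ _ => ?_⟩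
    obtain ⟨c, hc⟩ := toVertex_surjective v
    exact ⟨fun _ => c, by simpa using hc, by simp⟩

/-! A set `Y` of vertices is identified with the subcomplex of the curve complex which it spans.
A map `Y → Vertex M P` is given by a function on all vertices, of which only the values on `Y`
matter. -/

open Classical in
/-- `φ` is a simplicial map from the subcomplex spanned by `Y` to the curve complex. -/
def IsSimplicialOn (Y : Set (Vertex M P)) (φ : Vertex M P → Vertex M P) : Prop :=
  ∀ s ∈ (curveComplex M P).faces, (s : Set (Vertex M P)) ⊆ Y →
    s.image φ ∈ (curveComplex M P).faces

/-- The vertices of the star of `v` in the subcomplex spanned by `Y`. -/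
def starIn (Y : Set (Vertex M P)) (v : Vertex M P) : Set (Vertex M P) :=
  {w | ∃ s ∈ (curveComplex M P).faces, (s : Set (Vertex M P)) ⊆ Y ∧ v ∈ s ∧ w ∈ s}

/-- `φ` is injective on the star of every vertex of `Y`. -/
def IsLocallyInjectiveOn (Y : Set (Vertex M P)) (φ : Vertex M P → Vertex M P) : Prop :=
  ∀ v ∈ Y, Set.InjOn φ (starIn Y v)

/-- `Y` is rigid: every locally injective simplicial map `φ : Y → C(S)` is the restriction of
some `h ∈ Mod^±(S)`, unique up to the pointwise stabilizer of `Y`. -/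
def IsRigid (Y : Set (Vertex M P)) : Prop :=
  ∀ φ : Vertex M P → Vertex M P, IsSimplicialOn Y φ → IsLocallyInjectiveOn Y φ →
    ∃ h : ExtMod M P, (∀ y ∈ Y, h • y = φ y) ∧
      ∀ h' : ExtMod M P, (∀ y ∈ Y, h' • y = φ y) → h⁻¹ * h' ∈ fixingSubgroup (ExtMod M P) Y

/-- `Y` is weakly rigid: elements of `Mod^±(S)` that agree on `Y` are equal. -/
def IsWeaklyRigid (Y : Set (Vertex M P)) : Prop :=
  ∀ h h' : ExtMod M P, (∀ y ∈ Y, h • y = h' • y) → h = h'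

end Complex

section Twists

variable {M : Type*} [TopologicalSpace M] [ChartedSpace ℂ M] {P : Set M}

/-- `e` restricts to an orientation preserving embedding of the compact set `K ⊆ ℂ` into the
Hausdorff surface `M`; values of `e` outside `K` do not matter. -/
def IsOrientedEmbeddingOn (K : Set ℂ) (e : ℂ → M) : Prop :=
  ContinuousOn e K ∧ Set.InjOn e K ∧
    ∀ z ∈ interior K, PreservesOrientationAt (chartAt ℂ (e z) ∘ e) z

/-- The closed annulus `1 ≤ |z| ≤ 2`. -/
def annulus : Set ℂ := {z | 1 ≤ ‖z‖ ∧ ‖z‖ ≤ 2}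

/-- The left twist of the annulus: in polar coordinates `(θ, 1 + t) ↦ (θ + 2 π t, 1 + t)`. -/
def annulusTwist (z : ℂ) : ℂ :=
  z * Complex.exp ((2 * Real.pi * (‖z‖ - 1) : ℝ) * Complex.I)

/-- The left half twist of the disk `|z| ≤ 2`: it is the identity on the boundary and rotates
`|z| ≤ 1` by a half turn, exchanging `1/2` and `-1/2`. Its square is the left twist of
the annulus, up to isotopy. -/
def diskHalfTwist (z : ℂ) : ℂ :=
  z * Complex.exp ((Real.pi * (max ‖z‖ 1 - 2) : ℝ) * Complex.I)

/-- `f` is the Dehn twist `T_α`: it is represented by a homeomorphism which is the left twist on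
an oriented annulus in `M \ P` with core in the class `α`, and the identity elsewhere. -/
def IsDehnTwist (α : Vertex M P) (f : ExtMod M P) : Prop :=
  ∃ (e : ℂ → M) (c : EssentialCurve M P) (h : homeoGroup M P),
    IsOrientedEmbeddingOn annulus e ∧ Disjoint (e '' annulus) P ∧
    c.carrier = e '' Metric.sphere 0 (3 / 2) ∧ c.toVertex = α ∧
    (∀ z ∈ annulus, (h : M ≃ₜ M) (e z) = e (annulusTwist z)) ∧
    (∀ x, x ∉ e '' annulus → (h : M ≃ₜ M) x = x) ∧
    (h : ExtMod M P) = f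

/-- `f` is a half twist `H_α`: the class `α` cuts off a disk with exactly two marked points
(a pair of pants containing two punctures), and `f` is represented by a homeomorphism
which is the left half twist on this disk, exchanging the two marked points, and the identity
elsewhere. -/
def IsHalfTwist (α : Vertex M P) (f : ExtMod M P) : Prop :=
  ∃ (e : ℂ → M) (c : EssentialCurve M P) (h : homeoGroup M P),
    IsOrientedEmbeddingOn (Metric.closedBall 0 2) e ∧
    e '' Metric.closedBall 0 2 ∩ P = {e (1 / 2), e (-1 / 2)} ∧
    c.carrier = e '' Metric.sphere 0 (3 / 2) ∧ c.toVertex = α ∧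
    (∀ z ∈ Metric.closedBall (0 : ℂ) 2, (h : M ≃ₜ M) (e z) = e (diskHalfTwist z)) ∧
    (∀ x, x ∉ e '' Metric.closedBall 0 2 → (h : M ≃ₜ M) x = x) ∧
    (h : ExtMod M P) = f

end Twists

end CurveComplex

end

/-! Rigidity glues along weakly rigid overlaps. Given a locally injective simplicial map on a union
of rigid sets, each piece has a mapping class inducing it there. If all pieces contain a common
weakly rigid set, these classes agree on it, hence are equal, and a single class induces the whole
map (`IsRigid.sUnion`).

For a generator `g`, translation preserves rigidity and `Y ∩ g • Y` is weakly rigid, so `Y ∪ g • Y`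
is rigid; the same holds for `g⁻¹`. All these sets contain `Y`, itself weakly rigid, so their union
is rigid (`IsRigid.enlarge`). Enlarging `Y` only enlarges the overlaps, so the step can be repeated.
The union of all stages is invariant under the generators and their inverses, hence contains the
whole orbit of `Y` (`closure_smul_subset_iUnion_enlarge`). -/

namespace CurveComplex

/-! ### Simplicial action of the extended mapping class group -/

section Invariance

variable {M : Type*} [TopologicalSpace M] {P : Set M}

/-- A homeomorphism carries any pair of representatives to a pair with equally many intersection
points. Applying this to `g⁻¹` as well gives equality. -/
theorem interNum_le_interNum_smul (g : ExtMod M P) (α β : Vertex M P) :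
    interNum (g • α) (g • β) ≤ interNum α β := by
  refine le_sInf ?_
  rintro n ⟨a, b, rfl, rfl, rfl⟩
  obtain ⟨h, rfl⟩ := QuotientGroup.mk_surjective g
  refine sInf_le ⟨h • a, h • b, rfl, rfl, ?_⟩
  rw [EssentialCurve.carrier_smul, EssentialCurve.carrier_smul,
    ← Set.image_inter (h : M ≃ₜ M).injective, (h : M ≃ₜ M).injective.encard_image]

/-- The geometric intersection number is invariant under the mapping class group. -/
theorem interNum_smul (g : ExtMod M P) (α β : Vertex M P) :
    interNum (g • α) (g • β) = interNum α β :=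
  le_antisymm (interNum_le_interNum_smul g α β) <| by
    simpa using interNum_le_interNum_smul g⁻¹ (g • α) (g • β)

open Classical in
/-- The extended mapping class group acts on the curve complex by simplicial automorphisms. -/
theorem image_smul_mem_faces (g : ExtMod M P) {s : Finset (Vertex M P)}
    (hs : s ∈ (curveComplex M P).faces) :
    s.image (g • ·) ∈ (curveComplex M P).faces := by
  obtain ⟨hne, h1, h2, h3⟩ := hs
  have pairwise_inter : ∀ n : ℕ∞, ((s : Set (Vertex M P)).Pairwise fun α β => interNum α β = n) →
      ((s.image (g • ·) : Finset (Vertex M P)) : Set (Vertex M P)).Pairwise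
        fun α β => interNum α β = n := by
    intro n hn
    rw [Finset.coe_image]
    rintro _ ⟨a, ha, rfl⟩ _ ⟨b, hb, rfl⟩ hab
    simpa only [interNum_smul] using hn ha hb fun h => hab (by rw [h])
  refine ⟨hne.image _, fun h => pairwise_inter _ (h1 h), fun h => pairwise_inter _ (h2 h),
    fun h h' => ?_⟩
  obtain ⟨r, hr, hd⟩ := h3 h h'
  obtain ⟨k, rfl⟩ := QuotientGroup.mk_surjective g
  -- The chosen disjoint representatives are transported by `k`; pulling the vertex back first
  -- defines the choice on every vertex.
  refine ⟨fun v => k • r ((k : ExtMod M P)⁻¹ • v), ?_, ?_⟩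
  · intro α hα
    obtain ⟨a, ha, rfl⟩ := Finset.mem_image.1 hα
    dsimp only
    rw [inv_smul_smul, ← mk_smul_toVertex, hr a ha]
  · rw [Finset.coe_image]
    rintro _ ⟨a, ha, rfl⟩ _ ⟨b, hb, rfl⟩ hab
    simp only [inv_smul_smul, EssentialCurve.carrier_smul]
    exact (Set.disjoint_image_iff (k : M ≃ₜ M).injective).2
      (hd ha hb fun h => hab (by rw [h]))

end Invariance

/-! ### Restricting and translating locally injective simplicial maps -/

section Rigidity

variable {M : Type*} [TopologicalSpace M] {P : Set M} {A B W Y : Set (Vertex M P)}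
  {φ : Vertex M P → Vertex M P}

theorem IsSimplicialOn.mono (h : IsSimplicialOn B φ) (hAB : A ⊆ B) : IsSimplicialOn A φ :=
  fun s hs hsA => h s hs (hsA.trans hAB)

theorem starIn_mono (hAB : A ⊆ B) (v : Vertex M P) : starIn A v ⊆ starIn B v :=
  fun _ ⟨s, hs, hsA, hv, hw⟩ => ⟨s, hs, hsA.trans hAB, hv, hw⟩

theorem IsLocallyInjectiveOn.mono (h : IsLocallyInjectiveOn B φ) (hAB : A ⊆ B) :
    IsLocallyInjectiveOn A φ :=
  fun v hv => (h v (hAB hv)).mono (starIn_mono hAB v)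

theorem smul_mem_starIn (g : ExtMod M P) {v w : Vertex M P} (hw : w ∈ starIn Y v) :
    g • w ∈ starIn (g • Y) (g • v) := by
  classical
  obtain ⟨s, hs, hsY, hv, hw⟩ := hw
  refine ⟨s.image (g • ·), image_smul_mem_faces g hs, ?_, Finset.mem_image_of_mem _ hv,
    Finset.mem_image_of_mem _ hw⟩
  rw [Finset.coe_image]
  exact Set.image_mono hsY

/-- Precomposing with `g` turns a test map on the translate into one on `Y`, where rigidity of `Y`
applies. -/
theorem IsSimplicialOn.comp_smul {g : ExtMod M P} (h : IsSimplicialOn (g • Y) φ) :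
    IsSimplicialOn Y fun v => φ (g • v) := by
  classical
  intro s hs hsY
  have := h _ (image_smul_mem_faces g hs) (by
    rw [Finset.coe_image]
    exact Set.image_mono hsY)
  rw [Finset.image_image] at this
  convert this
  rfl

theorem IsLocallyInjectiveOn.comp_smul {g : ExtMod M P} (h : IsLocallyInjectiveOn (g • Y) φ) :
    IsLocallyInjectiveOn Y fun v => φ (g • v) :=
  fun v hv _ ha _ hb hab => smul_left_cancel g <|
    h (g • v) (Set.smul_mem_smul_set hv) (smul_mem_starIn g ha) (smul_mem_starIn g hb) hab

/-! ### Translates and unions of rigid sets -/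

/-- Mapping classes inducing the same map on `Y` differ by the pointwise stabilizer of `Y`, so
rigidity only asks for existence. -/
theorem isRigid_iff : IsRigid Y ↔ ∀ φ : Vertex M P → Vertex M P, IsSimplicialOn Y φ →
    IsLocallyInjectiveOn Y φ → ∃ h : ExtMod M P, ∀ y ∈ Y, h • y = φ y := by
  refine ⟨fun hY φ h1 h2 => (hY φ h1 h2).imp fun _ h => h.1, fun hY φ h1 h2 => ?_⟩
  obtain ⟨h, hh⟩ := hY φ h1 h2
  refine ⟨h, hh, fun h' hh' => (mem_fixingSubgroup_iff _).2 fun y hy => ?_⟩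
  rw [mul_smul, hh' y hy, ← hh y hy, inv_smul_smul]

/-- Translates of rigid sets are rigid. -/
theorem IsRigid.smul (hY : IsRigid Y) (g : ExtMod M P) : IsRigid (g • Y) := by
  refine isRigid_iff.2 fun φ h1 h2 => ?_
  obtain ⟨h, hh⟩ := isRigid_iff.1 hY _ h1.comp_smul h2.comp_smul
  -- `h` induces `φ ∘ g` on `Y`, so `g` has to be undone first.
  refine ⟨h * g⁻¹, ?_⟩
  rintro _ ⟨y, hy, rfl⟩
  simpa [mul_smul] using hh y hy

theorem IsWeaklyRigid.mono (hA : IsWeaklyRigid A) (hAB : A ⊆ B) : IsWeaklyRigid B :=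
  fun h h' hh => hA h h' fun y hy => hh y (hAB hy)

theorem IsWeaklyRigid.smul (hY : IsWeaklyRigid Y) (g : ExtMod M P) : IsWeaklyRigid (g • Y) :=
  fun h h' hh => mul_right_cancel (b := g) <| hY _ _ fun y hy => by
    simpa only [mul_smul] using hh _ (Set.smul_mem_smul_set hy)

theorem IsWeaklyRigid.fixingSubgroup_eq_bot (hY : IsWeaklyRigid Y) :
    fixingSubgroup (ExtMod M P) Y = ⊥ :=
  (Subgroup.eq_bot_iff_forall _).2 fun h hh => hY h 1 fun y hy => by
    rw [one_smul]
    exact (mem_fixingSubgroup_iff _).1 hh y hy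

/-- The union of rigid sets which share a weakly rigid set is rigid. -/
theorem IsRigid.sUnion {S : Set (Set (Vertex M P))} (hne : S.Nonempty)
    (hS : ∀ A ∈ S, IsRigid A) (hW : IsWeaklyRigid W) (hWS : ∀ A ∈ S, W ⊆ A) :
    IsRigid (⋃₀ S) := by
  refine isRigid_iff.2 fun φ h1 h2 => ?_
  have key : ∀ A ∈ S, ∃ h : ExtMod M P, ∀ y ∈ A, h • y = φ y := fun A hA =>
    isRigid_iff.1 (hS A hA) φ (h1.mono (Set.subset_sUnion_of_mem hA))
      (h2.mono (Set.subset_sUnion_of_mem hA))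
  obtain ⟨A, hA⟩ := hne
  obtain ⟨h, hh⟩ := key A hA
  refine ⟨h, ?_⟩
  rintro y ⟨B, hB, hy⟩
  obtain ⟨k, hk⟩ := key B hB
  -- Both classes induce `φ` on `W`, so weak rigidity identifies them.
  rw [hW h k fun w hw => (hh w (hWS A hA hw)).trans (hk w (hWS B hB hw)).symm]
  exact hk y hy

theorem IsRigid.union (hA : IsRigid A) (hB : IsRigid B) (hAB : IsWeaklyRigid (A ∩ B)) :
    IsRigid (A ∪ B) := by
  rw [← Set.sUnion_pair]
  refine IsRigid.sUnion (Set.insert_nonempty _ _) ?_ hAB ?_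
  · rintro C (rfl | rfl) <;> assumption
  · rintro C (rfl | rfl)
    exacts [Set.inter_subset_left, Set.inter_subset_right]

/-! ### Enlargement by generators and exhaustion of the orbit -/

/-- The union of the translates of `Y` under `1` and the elements of `T` and their inverses
(for nonempty `T`). -/
def enlarge (T : Set (ExtMod M P)) (Y : Set (Vertex M P)) : Set (Vertex M P) :=
  ⋃₀ ((fun g => Y ∪ g • Y) '' (T ∪ T⁻¹))

theorem union_smul_subset_enlarge {T : Set (ExtMod M P)} {g : ExtMod M P} (hg : g ∈ T ∪ T⁻¹)
    (Y : Set (Vertex M P)) : Y ∪ g • Y ⊆ enlarge T Y :=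
  Set.subset_sUnion_of_mem (Set.mem_image_of_mem _ hg)

theorem subset_enlarge {T : Set (ExtMod M P)} (hT : T.Nonempty) (Y : Set (Vertex M P)) :
    Y ⊆ enlarge T Y :=
  Set.subset_union_left.trans (union_smul_subset_enlarge (Or.inl hT.some_mem) Y)

theorem finite_enlarge {T : Set (ExtMod M P)} (hT : T.Finite) (hY : Y.Finite) :
    (enlarge T Y).Finite := by
  refine ((hT.union hT.inv).image _).sUnion ?_
  rintro _ ⟨g, -, rfl⟩
  exact hY.union hY.smul_set

/-- Gluing happens twice: `Y` to each translate along their overlap, then all the resulting sets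
along `Y`. -/
theorem IsRigid.enlarge {T : Set (ExtMod M P)} (hT : T.Nonempty) (hY : IsRigid Y)
    (hW : ∀ g ∈ T, IsWeaklyRigid (Y ∩ g • Y)) : IsRigid (enlarge T Y) := by
  have hW' : ∀ g ∈ T ∪ T⁻¹, IsWeaklyRigid (Y ∩ g • Y) := by
    rintro g (hg | hg)
    · exact hW g hg
    -- Here `g⁻¹ ∈ T`; translating `Y ∩ g⁻¹ • Y` by `g` gives the overlap for `g`.
    · have := (hW _ hg).smul g
      rwa [Set.smul_set_inter, smul_inv_smul, Set.inter_comm] at this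
  refine IsRigid.sUnion (W := Y) ⟨_, Set.mem_image_of_mem _ (Or.inl hT.some_mem)⟩ ?_
    ((hW _ hT.some_mem).mono Set.inter_subset_left) ?_
  · rintro _ ⟨g, hg, rfl⟩
    exact hY.union (hY.smul g) (hW' g hg)
  · rintro _ ⟨g, -, rfl⟩
    exact Set.subset_union_left

/-- Containment of `Y` is proved along with rigidity because it makes each later overlap contain the
original one, so the hypothesis on `Y` alone serves every stage. -/
theorem isRigid_enlarge_iterate {T : Set (ExtMod M P)} (hT : T.Nonempty) (hY : IsRigid Y)
    (hW : ∀ g ∈ T, IsWeaklyRigid (Y ∩ g • Y)) (n : ℕ) :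
    Y ⊆ (CurveComplex.enlarge T)^[n] Y ∧ IsRigid ((CurveComplex.enlarge T)^[n] Y) := by
  induction n with
  | zero => exact ⟨subset_rfl, hY⟩
  | succ n ih =>
    rw [Function.iterate_succ_apply']
    exact ⟨ih.1.trans (subset_enlarge hT _), ih.2.enlarge hT fun g hg =>
      (hW g hg).mono (Set.inter_subset_inter ih.1 (Set.smul_set_mono ih.1))⟩

/-- Iterated enlargement exhausts the orbit of `Y` under the subgroup generated by `T`. -/
theorem closure_smul_subset_iUnion_enlarge (T : Set (ExtMod M P)) (Y : Set (Vertex M P)) :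
    (Subgroup.closure T : Set (ExtMod M P)) • Y ⊆ ⋃ n, (enlarge T)^[n] Y := by
  have hsub : ∀ g ∈ T ∪ T⁻¹,
      g • (⋃ n, (enlarge T)^[n] Y) ⊆ ⋃ n, (enlarge T)^[n] Y := by
    intro g hg
    rw [Set.smul_set_iUnion]
    refine Set.iUnion_subset fun n => Set.subset_iUnion_of_subset (n + 1) ?_
    rw [Function.iterate_succ_apply']
    exact Set.subset_union_right.trans (union_smul_subset_enlarge hg _)
  have hle : Subgroup.closure T ≤
      MulAction.stabilizer (ExtMod M P) (⋃ n, (enlarge T)^[n] Y) := by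
    -- Stabilizing the union requires equality; the reverse inclusion is `hsub` for `g⁻¹`, which is
    -- why enlargement includes inverses.
    refine (Subgroup.closure_le _).2 fun g hg => (hsub g (Or.inl hg)).antisymm ?_
    rw [Set.subset_smul_set_iff]
    exact hsub g⁻¹ (Or.inr (Set.inv_mem_inv.2 hg))
  rintro _ ⟨g, hg, y, hy, rfl⟩
  have hgU : g • (⋃ n, (enlarge T)^[n] Y) = ⋃ n, (enlarge T)^[n] Y := hle hg
  dsimp only
  rw [← hgU]
  exact Set.smul_mem_smul_set (Set.mem_iUnion.2 ⟨0, hy⟩)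

end Rigidity

end CurveComplex

theorem proposition3p13 {M : Type*} [TopologicalSpace M] [T2Space M] [CompactSpace M]
    [ConnectedSpace M] [ChartedSpace ℂ M] [CurveComplex.OrientedAtlas M]
    (P : Set M) (hP : P.Finite) (hS : ¬ CurveComplex.IsS12 M P)
    (Y : Set (CurveComplex.Vertex M P)) (hYfin : Y.Finite) (hY : CurveComplex.IsRigid Y)
    (hYorbit : (CurveComplex.ModGroup M P : Set (CurveComplex.ExtMod M P)) • Y = Set.univ)
    (G : Set (CurveComplex.Vertex M P)) (hGY : G ⊆ Y) (hG : G.Nonempty)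
    (f : CurveComplex.Vertex M P → CurveComplex.ExtMod M P)
    (hf : ∀ α ∈ G, CurveComplex.IsDehnTwist α (f α) ∨ CurveComplex.IsHalfTwist α (f α))
    (hgen : Subgroup.closure (f '' G) = CurveComplex.ModGroup M P)
    (hweak : ∀ α ∈ G, CurveComplex.IsWeaklyRigid (Y ∩ f α • Y)) :
    ∃ Z : ℕ → Set (CurveComplex.Vertex M P),
      Z 0 = Y ∧ Monotone Z ∧
      (∀ n, (Z n).Finite ∧ CurveComplex.IsRigid (Z n) ∧
        fixingSubgroup (CurveComplex.ExtMod M P) (Z n) = ⊥) ∧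
      ⋃ n, Z n = Set.univ := by
  have hT : (f '' G).Nonempty := hG.image f
  have hTfin : (f '' G).Finite := (hYfin.subset hGY).image f
  have hW : ∀ g ∈ f '' G, CurveComplex.IsWeaklyRigid (Y ∩ g • Y) := by
    rintro _ ⟨α, hα, rfl⟩
    exact hweak α hα
  -- Since `G` is nonempty, `Y` contains at least one weakly rigid overlap.
  have hYweak : CurveComplex.IsWeaklyRigid Y :=
    (hW _ hT.some_mem).mono Set.inter_subset_left
  refine ⟨fun n => (CurveComplex.enlarge (f '' G))^[n] Y, rfl, monotone_nat_of_le_succ fun n => ?_,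
    fun n => ⟨?_, ?_, ?_⟩, ?_⟩
  · rw [Function.iterate_succ_apply']
    exact CurveComplex.subset_enlarge hT _
  · induction n with
    | zero => exact hYfin
    | succ n ih =>
      dsimp only
      rw [Function.iterate_succ_apply']
      exact CurveComplex.finite_enlarge hTfin ih
  · exact (CurveComplex.isRigid_enlarge_iterate hT hY hW n).2
  · exact (hYweak.mono
      (CurveComplex.isRigid_enlarge_iterate hT hY hW n).1).fixingSubgroup_eq_bot
  · refine Set.univ_subset_iff.1 ?_
    rw [← hYorbit, ← hgen]
    exact CurveComplex.closure_smul_subset_iUnion_enlarge _ _
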